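/- **Setting.** Let $G(\mathcal V,\mathcal E)$ be a finite directed graph without self-loops whose nodes are called agents, let $\mathcal I_i$ be the set of incoming neighbours of agent $i$, and let $f\ge 0$ be an integer. *Reduced graphs.* A reduced graph $\mathcal H$ of $G$ is obtained by (i) removing up to $f$ incoming links of each agent, and then (ii) removing up to $f$ sinks (nodes without outgoing links) of the graph obtained in (i). A source component of a graph is a strongly connected component that has no incoming link from outside the component. *Condition 1.* Every reduced graph $\mathcal H$ of $G$ has a unique source component $\mathcal S_{\mathcal H}$. *Signals.* Let $\Theta$ be a finite set of hypotheses. For each agent $i$ and each $\theta\in\Theta$ let $\ell_i(\cdot\,|\,\theta)$ be a probability mass function on a finite set $\mathcal W_i$ (the signal space of agent $i$) with $\ell_i(w\,|\,\theta)>0$ for all $w\in\mathcal W_i$. *Assumption 1.* For all $\theta\ne\theta'$ in $\Theta$ and every reduced graph $\mathcal H$ of $G$, $$\sum_{i\in \mathcal S_{\mathcal H}} D\big(\ell_i(\cdot\,|\,\theta')\,\|\,\ell_i(\cdot\,|\,\theta)\big)\neq 0,\qquad D(p\,\|\,q)=\sum_{w}p(w)\log\frac{p(w)}{q(w)} .$$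 *True state.* Let $\theta^*\in\Theta$. The signals $s^i_t$ ($t\ge 1$, $i\in\mathcal V$) are independent over time and agents, and $s^i_t$ has distribution $\ell_i(\cdot\,|\,\theta^*)$. *Crashes and delays.* Let $\mathcal N[t]$ be the set of agents that have not crashed by the beginning of iteration $t\ge 1$, so that $\mathcal N[t+1]\subseteq\mathcal N[t]$ is the set of agents that complete iteration $t$. Let $\mathcal N=\bigcap_t\mathcal N[t]$ be the set of non-faulty agents; at most $f$ agents are faulty, $|\mathcal V\setminus\mathcal N|\le f$. In iteration $t$ every agent $i\in\mathcal N[t+1]$ receives the iteration-$t$ messages of a set $\mathcal R_i[t]\subseteq\mathcal I_i\cap\mathcal N[t]$ of exactly $|\mathcal I_i|-f$ incoming neighbours; because message delays are arbitrary (but finite), these sets are otherwise arbitrary. The crash pattern and the receive sets $(\mathcal N[t],\mathcal R_i[t])_{t,i}$ are deterministic or, more generally, random and independent of the signals. *Learning rule.* The initial beliefs $\mu^i_0$ are probability distributions on $\Theta$ with $\mu_0^i(\theta)>0$ for all $\theta$ (for example uniform). For $t\ge 1$, each agent $i\in\mathcal N[t+1]$ sets, for every $\theta\in\Theta$, $$\mu^i_t(\theta)=\frac{\ell_i(s^i_t\,|\,\theta)\prod_{j\in\mathcal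 R_i[t]\cup\{i\}}\mu^j_{t-1}(\theta)^{\frac1{|\mathcal I_i|-f+1}}}{\sum_{\theta'\in\Theta}\ell_i(s^i_t\,|\,\theta')\prod_{j\in\mathcal R_i[t]\cup\{i\}}\mu^j_{t-1}(\theta')^{\frac1{|\mathcal I_i|-f+1}}} .$$ **Theorem.** If $G$ satisfies Condition 1 and Assumption 1 holds, then every non-faulty agent learns the true hypothesis almost surely: with probability one, $\lim_{t\to\infty}\mu^i_t(\theta^*)=1$ for all $i\in\mathcal N$. -/

import Mathlib

open scoped Topology
open MeasureTheory ProbabilityTheory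

noncomputable section

namespace CrashLearning

/-! ### Networks, reduced graphs and source components -/

/-- A directed graph on a subset `verts` of the agents `V`. -/
structure SubDigraph (V : Type*) where
  verts : Finset V
  Adj : V → V → Prop
  mem_left : ∀ {i j}, Adj i j → i ∈ verts
  mem_right : ∀ {i j}, Adj i j → j ∈ verts

open Classical in
/-- The incoming neighbours of agent `i`; a link `G.Adj j i` goes from `j` to `i`. -/
def inNeighbors {V : Type*} [Fintype V] (G : Digraph V) (i : V) : Finset V :=
  Finset.univ.filter fun j => G.Adj j i

open Classical in
/-- `H` is a reduced graph of `G`: (i) for each node up to `f` incoming links are removed from `G`,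
which leaves a graph `K` on all nodes; (ii) up to `f` sinks of `K` (nodes without outgoing links
in `K`) are removed, together with their links. Removing nothing is allowed in both steps. -/
def IsReducedGraph {V : Type*} [Fintype V] (G : Digraph V) (f : ℕ) (H : SubDigraph V) : Prop :=
  ∃ (K : Digraph V) (Z : Finset V),
    (∀ i j, K.Adj i j → G.Adj i j) ∧
    (∀ i, (inNeighbors G i \ inNeighbors K i).card ≤ f) ∧
    (∀ z ∈ Z, ∀ j, ¬ K.Adj z j) ∧
    Z.card ≤ f ∧
    H.verts = Finset.univ \ Z ∧
    (∀ i j, H.Adj i j ↔ K.Adj i j ∧ i ∉ Z ∧ j ∉ Z)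

/-- There is a directed path (possibly of length `0`) from `i` to `j` in `H`. -/
def SubDigraph.Reaches {V : Type*} (H : SubDigraph V) (i j : V) : Prop :=
  Relation.ReflTransGen H.Adj i j

/-- `S` is a strongly connected component of `H`: the set of all nodes that are mutually reachable
with some given node of `H`. -/
def SubDigraph.IsStrongComponent {V : Type*} (H : SubDigraph V) (S : Finset V) : Prop :=
  ∃ v ∈ H.verts, ∀ u, u ∈ S ↔ u ∈ H.verts ∧ H.Reaches u v ∧ H.Reaches v u

/-- A source component is a strongly connected component without incoming links from outside. -/
def SubDigraph.IsSourceComponent {V : Type*} (H : SubDigraph V) (S : Finset V) : Prop :=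
  H.IsStrongComponent S ∧ ∀ u v, u ∉ S → v ∈ S → ¬ H.Adj u v

/-- Every reduced graph of `G` contains a unique source component. -/
def UniqueSourceCondition {V : Type*} [Fintype V] (G : Digraph V) (f : ℕ) : Prop :=
  ∀ H : SubDigraph V, IsReducedGraph G f H → ∃! S : Finset V, H.IsSourceComponent S

/-! ### Signals and identifiability -/

/-- Kullback–Leibler divergence `D(p ‖ q)` of two probability mass functions on a finite set. -/
def kl {S : Type*} [Fintype S] (p q : S → ℝ) : ℝ :=
  ∑ w, p w * Real.log (p w / q w)

/-- `ℓ i θ` is a probability mass function on the signal space of agent `i`, with full support. -/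
structure IsSignalStructure {V Θ : Type*} {S : V → Type*} [∀ i, Fintype (S i)]
    (ℓ : (i : V) → Θ → S i → ℝ) : Prop where
  pos : ∀ i θ w, 0 < ℓ i θ w
  sum_eq_one : ∀ i θ, ∑ w, ℓ i θ w = 1

/-- In every reduced graph, the agents of the source component collectively distinguish any two
different hypotheses. -/
def SourceIdentifiable {V Θ : Type*} [Fintype V] {S : V → Type*} [∀ i, Fintype (S i)]
    (G : Digraph V) (f : ℕ) (ℓ : (i : V) → Θ → S i → ℝ) : Prop :=
  ∀ θ θ' : Θ, θ ≠ θ' → ∀ H : SubDigraph V, IsReducedGraph G f H →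
    ∀ C : Finset V, H.IsSourceComponent C → ∑ i ∈ C, kl (ℓ i θ') (ℓ i θ) ≠ 0

/-! ### Asynchronous executions with crashes -/

/-- The crash pattern and the receive sets of an execution. Iterations are numbered from `1`.
`alive t` is the set of agents that have not crashed by the end of iteration `t`, that is, by the
beginning of iteration `t + 1`. `recv t i` is the set of incoming neighbours whose messages tagged
`t` are used by agent `i` in iteration `t` (relevant for `t ≥ 1` and for agents that complete
iteration `t` only). Message delays enter through `recv` only. -/
structure Schedule (V : Type*) where
  alive : ℕ → Finset V
  recv : ℕ → V → Finset V

/-- The smallest σ-algebra for which all `alive t` and `recv t i` are measurable. -/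
instance Schedule.instMeasurableSpace {V : Type*} : MeasurableSpace (Schedule V) :=
  MeasurableSpace.comap (fun σ => (σ.alive, σ.recv)) inferInstance

open Classical in
/-- The agents that never crash. -/
def Schedule.nonFaulty {V : Type*} [Fintype V] (σ : Schedule V) : Finset V :=
  Finset.univ.filter fun i => ∀ t, i ∈ σ.alive t

open Classical in
/-- The schedules that can arise in network `G` with up to `f` crashes and arbitrary finite message
delays: crashed agents stay crashed, at most `f` agents crash, and every agent that completes
iteration `t` has received the messages of exactly `|I_i| - f` incoming neighbours (written without
subtraction), all of which had not crashed by the beginning of iteration `t`. -/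
structure Schedule.IsAdmissible {V : Type*} [Fintype V] (G : Digraph V) (f : ℕ)
    (σ : Schedule V) : Prop where
  alive_antitone : ∀ t, σ.alive (t + 1) ⊆ σ.alive t
  card_faulty_le : (Finset.univ \ σ.nonFaulty).card ≤ f
  recv_subset : ∀ t, ∀ i ∈ σ.alive (t + 1), σ.recv (t + 1) i ⊆ inNeighbors G i ∩ σ.alive t
  recv_card : ∀ t, ∀ i ∈ σ.alive (t + 1), (σ.recv (t + 1) i).card + f = (inNeighbors G i).card

open Classical in
/-- The unnormalized new belief of agent `i` in `θ`, when it observes the signal `w`, uses the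
messages of the agents in `R`, and the current beliefs are `b`. -/
def weight {V Θ : Type*} [Fintype V] {S : V → Type*} (G : Digraph V) (f : ℕ)
    (ℓ : (i : V) → Θ → S i → ℝ) (i : V) (w : S i) (R : Finset V) (b : V → Θ → ℝ) (θ : Θ) : ℝ :=
  ℓ i θ w * ∏ j ∈ insert i R, b j θ ^ (1 / (((inNeighbors G i).card : ℝ) - f + 1))

/-- `μ t i θ` are the beliefs after iteration `t`, in the execution with schedule `σ`, signals `s`
(`s t i` is observed by agent `i` in iteration `t`, for `t ≥ 1`) and initial beliefs `μ₀`. An agent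
that completes an iteration performs the geometric-averaging update; nothing is required of the
values `μ t i` of an agent that has crashed by the end of iteration `t ≥ 1`. -/
structure IsBeliefEvolution {V Θ : Type*} [Fintype V] [Fintype Θ] {S : V → Type*}
    (G : Digraph V) (f : ℕ) (ℓ : (i : V) → Θ → S i → ℝ) (μ₀ : V → Θ → ℝ)
    (σ : Schedule V) (s : ℕ → (i : V) → S i) (μ : ℕ → V → Θ → ℝ) : Prop where
  init : ∀ i θ, μ 0 i θ = μ₀ i θ
  step : ∀ t, ∀ i ∈ σ.alive (t + 1), ∀ θ,
    μ (t + 1) i θ =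
      weight G f ℓ i (s (t + 1) i) (σ.recv (t + 1) i) (μ t) θ /
        ∑ θ', weight G f ℓ i (s (t + 1) i) (σ.recv (t + 1) i) (μ t) θ'

end CrashLearning

end

/-!
Fix a false hypothesis `θ`. Geometric averaging of beliefs is linear in the log-belief ratios
`log (μ t i θ / μ t i θstar)`: each agent averages the ratios it has received with its own and adds
the log-likelihood ratio of its new signal (`IsBeliefEvolution.log_ratio_succ`). Unrolling this, the
ratio at time `t` is a bounded term plus the sum of all past log-likelihood ratios, weighted by
products of row-stochastic matrices (`IsBeliefEvolution.log_ratio_eq`). It suffices that this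
accumulated evidence tends to `-∞`.

*Fixed schedule.* The weights are numbers in `[0, 1]` and the signals are independent, so the
exponential moment of half the evidence factorizes. By Jensen's inequality a factor with weight `w`
is at most `ρ ^ w`, where `ρ = ∑ √(ℓ θ * ℓ θstar)` is the Hellinger affinity of the signal laws of the
agent concerned; `ρ ≤ 1`, with strict inequality exactly for the agents that can tell `θ` from
`θstar` (`Schedule.lintegral_exp_accumulated_le`). So the moment is at most
`exp (-∑ r, (transition (r + 1) t *ᵥ δ) i)` with `δ j = -log ρ j ≥ 0`. If the terms of this sum are
bounded below, the moments are summable in `t`, and the evidence tends to `-∞` almost surely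
(`Schedule.IsAdmissible.ae_tendsto_accumulated`).

*Lower bound.* After the last crash, the messages used in one iteration form a reduced graph on the
non-faulty agents (`Schedule.IsAdmissible.isReducedGraph_messageGraph`). Let `P` be a set of
non-faulty agents containing all those with `δ > 0`. If no message went from `P` to the other
non-faulty agents, these would contain a source component on which `δ` vanishes, which
identifiability forbids. Hence the set of agents influenced by the support of `δ` gains a member in
every iteration until it contains all non-faulty agents, which takes at most `|V|` iterations and
costs a bounded factor per iteration (`Schedule.IsAdmissible.exists_pos_le_transition_mulVec`).

*Random schedule.* Fubini's theorem reduces the independent case to that of a fixed schedule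
(`ae_mem_of_indepFun`).
-/

namespace CrashLearning

/-! ### Source components of the communication graphs -/

section Graph

variable {V : Type*} [Fintype V]

/-- A set of nodes that is closed under predecessors contains a source component: the strong
component of any of its nodes with the fewest ancestors. -/
lemma SubDigraph.exists_isSourceComponent_subset (H : SubDigraph V) {U : Finset V}
    (hne : U.Nonempty) (hU : U ⊆ H.verts) (hpred : ∀ u v, v ∈ U → H.Adj u v → u ∈ U) :
    ∃ C ⊆ U, H.IsSourceComponent C := by
  classical
  have hreach : ∀ u v, H.Reaches u v → v ∈ U → u ∈ U := by
    intro u v huv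
    induction huv with
    | refl => exact id
    | tail _ h ih => exact fun hv => ih (hpred _ _ hv h)
  obtain ⟨v, hv, hmin⟩ := U.exists_min_image
    (fun v => (Finset.univ.filter fun u => H.Reaches u v).card) hne
  refine ⟨H.verts.filter fun u => H.Reaches u v ∧ H.Reaches v u, ?_, ⟨v, hU hv, by simp⟩, ?_⟩
  · intro u hu
    exact hreach _ _ (Finset.mem_filter.1 hu).2.1 hv
  · intro w u hw hu hadj
    obtain ⟨-, huv, hvu⟩ := Finset.mem_filter.1 hu
    have hwv : H.Reaches w v := Relation.ReflTransGen.head hadj huv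
    have hsub : (Finset.univ.filter fun x => H.Reaches x w) ⊆
        Finset.univ.filter fun x => H.Reaches x v := by
      intro x hx
      simp only [Finset.mem_filter, Finset.mem_univ, true_and] at hx ⊢
      exact Relation.ReflTransGen.trans hx hwv
    have heq := Finset.eq_of_subset_of_card_le hsub (hmin w (hreach _ _ hwv hv))
    have hvw : v ∈ Finset.univ.filter fun x => H.Reaches x w := by
      rw [heq]
      simp only [Finset.mem_filter, Finset.mem_univ, true_and]
      exact Relation.ReflTransGen.refl
    exact hw (Finset.mem_filter.2 ⟨H.mem_left hadj, hwv, (Finset.mem_filter.1 hvw).2⟩)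

/-- The links between non-faulty agents over which messages are used in iteration `t`. -/
noncomputable def Schedule.messageGraph (σ : Schedule V) (t : ℕ) : SubDigraph V where
  verts := σ.nonFaulty
  Adj j i := j ∈ σ.nonFaulty ∧ i ∈ σ.nonFaulty ∧ j ∈ σ.recv t i
  mem_left h := h.1
  mem_right h := h.2.1

variable {G : Digraph V} {f : ℕ} {σ : Schedule V}

lemma mem_inNeighbors {i j : V} : j ∈ inNeighbors G i ↔ G.Adj j i := by
  simp [inNeighbors]

lemma Schedule.mem_nonFaulty {i : V} : i ∈ σ.nonFaulty ↔ ∀ t, i ∈ σ.alive t := by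
  simp [Schedule.nonFaulty]

/-- Once all faulty agents have crashed, the messages used in one iteration form a reduced graph:
a non-faulty agent ignores exactly `f` incoming links, a faulty one is cut off from the at most `f`
faulty agents, and this turns the faulty agents into sinks. -/
lemma Schedule.IsAdmissible.isReducedGraph_messageGraph (h : σ.IsAdmissible G f) {t : ℕ}
    (ht : σ.alive t = σ.nonFaulty) : IsReducedGraph G f (σ.messageGraph (t + 1)) := by
  classical
  refine ⟨⟨fun j i => if i ∈ σ.nonFaulty then j ∈ σ.recv (t + 1) i
    else G.Adj j i ∧ j ∈ σ.nonFaulty⟩, Finset.univ \ σ.nonFaulty, ?_, ?_, ?_, h.card_faulty_le,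
    ?_, ?_⟩
  · intro j i hji
    by_cases hi : i ∈ σ.nonFaulty
    · simp only [hi, if_true] at hji
      exact mem_inNeighbors.1
        (Finset.mem_inter.1 (h.recv_subset t i (mem_nonFaulty.1 hi _) hji)).1
    · simp only [hi, if_false] at hji
      exact hji.1
  · intro i
    by_cases hi : i ∈ σ.nonFaulty
    · have hR : inNeighbors (⟨fun j i => if i ∈ σ.nonFaulty then j ∈ σ.recv (t + 1) i
          else G.Adj j i ∧ j ∈ σ.nonFaulty⟩ : Digraph V) i = σ.recv (t + 1) i := by
        ext j
        simp [mem_inNeighbors, hi]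
      have hsub : σ.recv (t + 1) i ⊆ inNeighbors G i := fun j hj =>
        (Finset.mem_inter.1 (h.recv_subset t i (mem_nonFaulty.1 hi _) hj)).1
      rw [hR, Finset.card_sdiff_of_subset hsub]
      have := h.recv_card t i (mem_nonFaulty.1 hi _)
      omega
    · refine (Finset.card_le_card ?_).trans h.card_faulty_le
      intro j hj
      simp only [Finset.mem_sdiff, mem_inNeighbors, hi, if_false, Finset.mem_univ, true_and] at hj ⊢
      exact fun hjN => hj.2 ⟨hj.1, hjN⟩
  · intro z hz i hzi
    have hz' : z ∉ σ.nonFaulty := by simpa using hz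
    by_cases hi : i ∈ σ.nonFaulty
    · simp only [hi, if_true] at hzi
      have := (Finset.mem_inter.1 (h.recv_subset t i (mem_nonFaulty.1 hi _) hzi)).2
      exact hz' (ht ▸ this)
    · simp only [hi, if_false] at hzi
      exact hz' hzi.2
  · simp [Schedule.messageGraph]
  · intro j i
    simp only [Schedule.messageGraph, Finset.mem_sdiff, Finset.mem_univ, true_and, not_not]
    constructor
    · rintro ⟨hj, hi, hr⟩
      simp [hi, hj, hr]
    · rintro ⟨hr, hj, hi⟩
      simp only [hi, if_true] at hr
      exact ⟨hj, hi, hr⟩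

lemma Schedule.IsAdmissible.exists_alive_eq_nonFaulty (h : σ.IsAdmissible G f) :
    ∃ T, ∀ t, T ≤ t → σ.alive t = σ.nonFaulty := by
  classical
  have hanti : Antitone σ.alive := antitone_nat_of_succ_le h.alive_antitone
  have hex : ∀ i, ∃ t, i ∈ σ.alive t → i ∈ σ.nonFaulty := by
    intro i
    by_contra! hi
    exact (hi 0).2 (mem_nonFaulty.2 fun t => (hi t).1)
  choose τ hτ using hex
  refine ⟨Finset.univ.sup τ, fun t ht => Finset.Subset.antisymm (fun i hi => ?_) fun i hi =>
    mem_nonFaulty.1 hi t⟩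
  exact hτ i (hanti ((Finset.le_sup (Finset.mem_univ i)).trans ht) hi)

end Graph

/-! ### Averaging over received messages -/

section Averaging

variable {V : Type*} [Fintype V]

open Classical in
/-- The matrix of iteration `t`: row `i` averages uniformly over `i` and its received messages. -/
noncomputable def Schedule.avg (σ : Schedule V) (t : ℕ) : Matrix V V ℝ :=
  Matrix.of fun i j => if j ∈ insert i (σ.recv t i) then
    ((insert i (σ.recv t i)).card : ℝ)⁻¹ else 0

lemma Schedule.avg_nonneg {V : Type*} (σ : Schedule V) (t : ℕ) (i j : V) : 0 ≤ σ.avg t i j := by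
  simp only [Schedule.avg, Matrix.of_apply]
  split_ifs <;> positivity

open Classical in
/-- The backward product `A (t) * A (t - 1) * ⋯ * A (r + 1)` of the averaging matrices, which is the
identity for `t ≤ r`. -/
noncomputable def Schedule.transition (σ : Schedule V) (r : ℕ) : ℕ → Matrix V V ℝ
  | 0 => 1
  | t + 1 => if r ≤ t then σ.avg (t + 1) * σ.transition r t else 1

variable (σ : Schedule V)

open Classical in
lemma Schedule.avg_mulVec (t : ℕ) (x : V → ℝ) (i : V) :
    (σ.avg t).mulVec x i =
      ((insert i (σ.recv t i)).card : ℝ)⁻¹ * ∑ j ∈ insert i (σ.recv t i), x j := by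
  simp only [Matrix.mulVec, dotProduct, Schedule.avg, Matrix.of_apply, ite_mul, zero_mul,
    Finset.mul_sum]
  rw [← Finset.sum_filter]
  exact Finset.sum_congr (by ext; simp) fun _ _ => rfl

lemma Schedule.transition_succ {r t : ℕ} (h : r ≤ t) :
    σ.transition r (t + 1) = σ.avg (t + 1) * σ.transition r t := by
  simp [Schedule.transition, h]

open Classical in
lemma Schedule.transition_of_le {r t : ℕ} (h : t ≤ r) : σ.transition r t = 1 := by
  cases t with
  | zero => rfl
  | succ t => simp [Schedule.transition, Nat.not_le.2 (Nat.lt_of_succ_le h)]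

/-- An average is at least any lower bound of the averaged values. -/
lemma Schedule.le_avg_mulVec {t : ℕ} {x : V → ℝ} {i : V} {c : ℝ} (hi : c ≤ x i)
    (h : ∀ j ∈ σ.recv t i, c ≤ x j) : c ≤ (σ.avg t).mulVec x i := by
  classical
  rw [σ.avg_mulVec, inv_mul_eq_div, le_div_iff₀ (by positivity), mul_comm, ← nsmul_eq_mul]
  refine Finset.card_nsmul_le_sum _ _ _ fun j hj => ?_
  rcases Finset.mem_insert.1 hj with rfl | hj
  exacts [hi, h j hj]

/-- An average of nonnegative values is at least a fixed fraction of each of them. -/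
lemma Schedule.inv_card_mul_le_avg_mulVec {t : ℕ} {x : V → ℝ} {i j : V} {c : ℝ}
    (hx : ∀ j, 0 ≤ x j) (hj : j = i ∨ j ∈ σ.recv t i) (hc : c ≤ x j) :
    ((Fintype.card V : ℝ) + 1)⁻¹ * c ≤ (σ.avg t).mulVec x i := by
  classical
  rw [σ.avg_mulVec]
  have h1 : c ≤ ∑ j ∈ insert i (σ.recv t i), x j :=
    hc.trans (Finset.single_le_sum (fun k _ => hx k) (Finset.mem_insert.2 hj))
  have h0 : 0 ≤ ∑ j ∈ insert i (σ.recv t i), x j := Finset.sum_nonneg fun k _ => hx k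
  have h2 : ((insert i (σ.recv t i)).card : ℝ) ≤ (Fintype.card V : ℝ) + 1 := by
    have : (insert i (σ.recv t i)).card ≤ Fintype.card V := Finset.card_le_univ _
    exact_mod_cast this.trans (Nat.le_succ _)
  have h3 : (0 : ℝ) < ((insert i (σ.recv t i)).card : ℝ) := by
    exact_mod_cast Finset.card_pos.2 ⟨i, Finset.mem_insert_self _ _⟩
  exact (mul_le_mul_of_nonneg_left h1 (by positivity)).trans
    (mul_le_mul_of_nonneg_right (inv_anti₀ h3 h2) h0)

lemma Schedule.avg_mulVec_one (t : ℕ) : (σ.avg t).mulVec 1 = 1 := by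
  classical
  ext i
  rw [σ.avg_mulVec]
  have h3 : ((insert i (σ.recv t i)).card : ℝ) ≠ 0 := by
    exact_mod_cast (Finset.card_pos.2 ⟨i, Finset.mem_insert_self _ _⟩).ne'
  simp only [Pi.one_apply, Finset.sum_const, nsmul_eq_mul, mul_one]
  exact inv_mul_cancel₀ h3

lemma Schedule.transition_nonneg (r t : ℕ) (i j : V) : 0 ≤ σ.transition r t i j := by
  classical
  induction t generalizing i with
  | zero =>
    rw [σ.transition_of_le (Nat.zero_le r), Matrix.one_apply]
    split_ifs <;> simp
  | succ t ih =>
    by_cases h : r ≤ t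
    · rw [σ.transition_succ h, Matrix.mul_apply]
      exact Finset.sum_nonneg fun k _ => mul_nonneg (σ.avg_nonneg _ _ _) (ih k)
    · rw [σ.transition_of_le (by omega), Matrix.one_apply]
      split_ifs <;> simp

lemma Schedule.transition_mulVec_one (r t : ℕ) : (σ.transition r t).mulVec 1 = 1 := by
  classical
  induction t with
  | zero => rw [σ.transition_of_le (Nat.zero_le r), Matrix.one_mulVec]
  | succ t ih =>
    by_cases h : r ≤ t
    · rw [σ.transition_succ h, ← Matrix.mulVec_mulVec, ih, σ.avg_mulVec_one]
    · rw [σ.transition_of_le (by omega), Matrix.one_mulVec]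

lemma Schedule.transition_le_one (r t : ℕ) (i j : V) : σ.transition r t i j ≤ 1 := by
  have h := congrFun (σ.transition_mulVec_one r t) i
  simp only [Matrix.mulVec, dotProduct, Pi.one_apply, mul_one] at h
  rw [← h]
  exact Finset.single_le_sum (fun k _ => σ.transition_nonneg r t i k) (Finset.mem_univ j)

lemma Schedule.transition_mulVec_nonneg (r t : ℕ) {x : V → ℝ} (hx : ∀ j, 0 ≤ x j) (i : V) :
    0 ≤ (σ.transition r t).mulVec x i :=
  Finset.sum_nonneg fun j _ => mul_nonneg (σ.transition_nonneg r t i j) (hx j)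

variable {σ} {G : Digraph V} {f : ℕ}

/-- If a nonnegative vector `x` is positive somewhere on every source component of every reduced
graph, then, from the last crash on, averaging it over at least `|V|` iterations produces values
bounded away from `0` at all non-faulty agents. -/
lemma Schedule.IsAdmissible.exists_pos_le_transition_mulVec (h : σ.IsAdmissible G f) {T : ℕ}
    (hT : ∀ t, T ≤ t → σ.alive t = σ.nonFaulty) {x : V → ℝ} (hx : ∀ j, 0 ≤ x j)
    (hpos : ∀ H, IsReducedGraph G f H → ∀ C, H.IsSourceComponent C → ∃ j ∈ C, 0 < x j) :
    ∃ c > 0, ∀ r ≥ T, ∀ t ≥ r + Fintype.card V, ∀ i ∈ σ.nonFaulty,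
      c ≤ (σ.transition r t).mulVec x i := by
  classical
  obtain ⟨m, hm, hmx⟩ : ∃ m > 0, ∀ j, 0 < x j → m ≤ x j := by
    by_cases hne : (Finset.univ.filter fun j => 0 < x j).Nonempty
    · obtain ⟨j, hj, hjm⟩ := Finset.exists_min_image _ x hne
      exact ⟨x j, (Finset.mem_filter.1 hj).2, fun k hk => hjm k (by simpa using hk)⟩
    · refine ⟨1, one_pos, fun j hj => (hne ⟨j, by simpa using hj⟩).elim⟩
  set α : ℝ := ((Fintype.card V : ℝ) + 1)⁻¹
  have hα0 : 0 < α := by positivity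
  have hα1 : α ≤ 1 := inv_le_one_of_one_le₀ (by simp)
  refine ⟨α ^ Fintype.card V * m, by positivity, fun r hr t ht => ?_⟩
  have hrecv : ∀ t ≥ T, ∀ i ∈ σ.nonFaulty, ∀ j ∈ σ.recv (t + 1) i, j ∈ σ.nonFaulty := by
    intro t ht i hi j hj
    have := (Finset.mem_inter.1 (h.recv_subset t i (mem_nonFaulty.1 hi _) hj)).2
    rwa [hT t ht] at this
  -- `P n` are the agents whose value after `n` iterations is at least `α ^ n * m`; it contains
  -- the support of `x` and gains an agent in every iteration until it exhausts the non-faulty ones.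
  set P : ℕ → Finset V := fun n => σ.nonFaulty.filter fun i =>
    α ^ n * m ≤ (σ.transition r (r + n)).mulVec x i with hP
  have hstep : ∀ n i, (σ.transition r (r + n + 1)).mulVec x i =
      (σ.avg (r + n + 1)).mulVec ((σ.transition r (r + n)).mulVec x) i := by
    intro n i
    rw [σ.transition_succ (Nat.le_add_right r n), Matrix.mulVec_mulVec]
  have hnn : ∀ n j, 0 ≤ (σ.transition r (r + n)).mulVec x j :=
    fun n j => σ.transition_mulVec_nonneg _ _ hx j
  have hgrow : ∀ n i j, i ∈ σ.nonFaulty → j ∈ P n → (j = i ∨ j ∈ σ.recv (r + n + 1) i) →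
      i ∈ P (n + 1) := by
    intro n i j hi hj hij
    refine Finset.mem_filter.2 ⟨hi, ?_⟩
    rw [← add_assoc, hstep, pow_succ', mul_assoc]
    exact σ.inv_card_mul_le_avg_mulVec (hnn n) hij (Finset.mem_filter.1 hj).2
  have hmono : ∀ n, P n ⊆ P (n + 1) := fun n i hi =>
    hgrow n i i (Finset.mem_filter.1 hi).1 hi (Or.inl rfl)
  have hsupp : ∀ n, ∀ i ∈ σ.nonFaulty, 0 < x i → i ∈ P n := by
    intro n i hi hxi
    induction n with
    | zero =>
      refine Finset.mem_filter.2 ⟨hi, ?_⟩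
      rw [add_zero, σ.transition_of_le le_rfl, Matrix.one_mulVec, pow_zero, one_mul]
      exact hmx i hxi
    | succ n ih => exact hmono n ih
  have hcard : ∀ n, min n σ.nonFaulty.card ≤ (P n).card := by
    intro n
    induction n with
    | zero => simp
    | succ n ih =>
      have hsub : P n ⊆ σ.nonFaulty := Finset.filter_subset _ _
      by_cases hlt : (P n).card < (P (n + 1)).card
      · omega
      have heq : P n = P (n + 1) := Finset.eq_of_subset_of_card_le (hmono n) (not_lt.1 hlt)
      suffices P n = σ.nonFaulty by
        rw [← heq, this]
        exact min_le_right _ _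
      -- Otherwise the remaining agents are closed under predecessors in the message graph, so they
      -- contain a source component, on which `x` vanishes.
      by_contra hne
      obtain ⟨C, hC, hsrc⟩ := (σ.messageGraph (r + n + 1)).exists_isSourceComponent_subset
        (U := σ.nonFaulty \ P n)
        (Finset.sdiff_nonempty.2 fun hle => hne (Finset.Subset.antisymm hsub hle))
        Finset.sdiff_subset (fun u v hv huv => by
          refine Finset.mem_sdiff.2 ⟨huv.1, fun hu => (Finset.mem_sdiff.1 hv).2 ?_⟩
          rw [heq]
          exact hgrow n v u huv.2.1 hu (Or.inr huv.2.2))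
      obtain ⟨j, hjC, hj⟩ := hpos _
        (h.isReducedGraph_messageGraph (hT (r + n) (by omega))) C hsrc
      have hjU := Finset.mem_sdiff.1 (hC hjC)
      exact hjU.2 (hsupp n j hjU.1 hj)
  obtain ⟨n, rfl⟩ : ∃ n, t = r + Fintype.card V + n := ⟨_, (Nat.add_sub_cancel' ht).symm⟩
  induction n with
  | zero =>
    have hfull : P (Fintype.card V) = σ.nonFaulty := by
      refine Finset.eq_of_subset_of_card_le (Finset.filter_subset _ _) ?_
      have h1 := hcard (Fintype.card V)
      have h2 : σ.nonFaulty.card ≤ Fintype.card V := Finset.card_le_univ _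
      omega
    intro i hi
    rw [← hfull] at hi
    exact (Finset.mem_filter.1 hi).2
  | succ n ih =>
    intro i hi
    have ih' := ih (by omega)
    rw [← add_assoc, add_assoc r, hstep]
    rw [add_assoc r] at ih'
    exact σ.le_avg_mulVec (ih' i hi) fun j hj => ih' j (hrecv _ (by omega) i hi j hj)

end Averaging

/-! ### Hellinger affinity and the moments of likelihood ratios -/

section Affinity

variable {S : Type*} [Fintype S]

/-- The Hellinger affinity (Bhattacharyya coefficient) `∑ √(p q)` of two probability mass
functions. -/
noncomputable def affinity (p q : S → ℝ) : ℝ :=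
  ∑ w, √(p w * q w)

variable {p q : S → ℝ}

lemma affinity_pos (hp : ∀ w, 0 < p w) (hq : ∀ w, 0 < q w) (hps : ∑ w, p w = 1) :
    0 < affinity p q := by
  have hne : (Finset.univ : Finset S).Nonempty := by
    by_contra h
    rw [Finset.not_nonempty_iff_eq_empty.1 h] at hps
    simp at hps
  exact Finset.sum_pos (fun w _ => Real.sqrt_pos.2 (mul_pos (hp w) (hq w))) hne

lemma one_sub_affinity (hp : ∀ w, 0 < p w) (hq : ∀ w, 0 < q w) (hps : ∑ w, p w = 1)
    (hqs : ∑ w, q w = 1) : 1 - affinity p q = ∑ w, (√(p w) - √(q w)) ^ 2 / 2 := by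
  have h : ∀ w, (√(p w) - √(q w)) ^ 2 / 2 = p w / 2 + q w / 2 - √(p w * q w) := by
    intro w
    rw [Real.sqrt_mul (hp w).le, sub_sq, Real.sq_sqrt (hp w).le, Real.sq_sqrt (hq w).le]
    ring
  simp only [h, Finset.sum_sub_distrib, Finset.sum_add_distrib, ← Finset.sum_div, hps, hqs,
    affinity]
  ring

lemma affinity_le_one (hp : ∀ w, 0 < p w) (hq : ∀ w, 0 < q w) (hps : ∑ w, p w = 1)
    (hqs : ∑ w, q w = 1) : affinity p q ≤ 1 := by
  have h := one_sub_affinity hp hq hps hqs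
  have : 0 ≤ ∑ w, (√(p w) - √(q w)) ^ 2 / 2 := Finset.sum_nonneg fun w _ => by positivity
  linarith

lemma affinity_lt_one (hp : ∀ w, 0 < p w) (hq : ∀ w, 0 < q w) (hps : ∑ w, p w = 1)
    (hqs : ∑ w, q w = 1) (hne : p ≠ q) : affinity p q < 1 := by
  obtain ⟨w, hw⟩ := Function.ne_iff.1 hne
  have h := one_sub_affinity hp hq hps hqs
  have : 0 < ∑ w, (√(p w) - √(q w)) ^ 2 / 2 := by
    refine Finset.sum_pos' (fun w _ => by positivity) ⟨w, Finset.mem_univ w, ?_⟩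
    have : √(p w) - √(q w) ≠ 0 := fun h0 =>
      hw ((Real.sqrt_inj (hp w).le (hq w).le).1 (sub_eq_zero.1 h0))
    positivity
  linarith

/-- Jensen's inequality for `x ↦ x ^ a`: the moment of order `a / 2` of the likelihood ratio `p / q`
under `q` is at most the `a`-th power of the Hellinger affinity. -/
lemma sum_mul_exp_log_div_le (hp : ∀ w, 0 < p w) (hq : ∀ w, 0 < q w) (hps : ∑ w, p w = 1)
    (hqs : ∑ w, q w = 1) {a : ℝ} (ha0 : 0 ≤ a) (ha1 : a ≤ 1) :
    ∑ w, q w * Real.exp (a * Real.log (p w / q w) / 2) ≤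
      Real.exp (a * Real.log (affinity p q)) := by
  have hz : ∀ w, Real.exp (a * Real.log (p w / q w) / 2) = √(p w / q w) ^ a := by
    intro w
    rw [Real.rpow_def_of_pos (Real.sqrt_pos.2 (div_pos (hp w) (hq w))),
      Real.log_sqrt (div_pos (hp w) (hq w)).le]
    ring_nf
  have hsum : ∑ w, q w * √(p w / q w) = affinity p q := by
    refine Finset.sum_congr rfl fun w _ => ?_
    rw [Real.sqrt_div (hp w).le, Real.sqrt_mul (hp w).le]
    have := Real.sqrt_ne_zero'.2 (hq w)
    field_simp
    rw [Real.sq_sqrt (hq w).le, mul_comm]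
  rw [mul_comm a, ← Real.rpow_def_of_pos (affinity_pos hp hq hps), ← hsum]
  simp only [hz]
  exact (Real.concaveOn_rpow ha0 ha1).le_map_sum (fun w _ => (hq w).le) hqs
    fun w _ => Real.sqrt_nonneg _

lemma lintegral_exp_log_div_le [MeasurableSpace S] [MeasurableSingletonClass S]
    (hp : ∀ w, 0 < p w) (hq : ∀ w, 0 < q w) (hps : ∑ w, p w = 1)
    (hqs : ∑ w, q w = 1) {Ω : Type*} [MeasurableSpace Ω] {P : Measure Ω} [IsFiniteMeasure P]
    {Y : Ω → S} (hY : Measurable Y) (hlaw : ∀ w, P.real {ω | Y ω = w} = q w)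
    {a : ℝ} (ha0 : 0 ≤ a) (ha1 : a ≤ 1) :
    ∫⁻ ω, ENNReal.ofReal (Real.exp (a * Real.log (p (Y ω) / q (Y ω)) / 2)) ∂P ≤
      ENNReal.ofReal (Real.exp (a * Real.log (affinity p q))) := by
  rw [← lintegral_map (f := fun w => ENNReal.ofReal (Real.exp (a * Real.log (p w / q w) / 2)))
    (Measurable.of_discrete) hY, lintegral_fintype]
  have hm : ∀ w, P.map Y {w} = ENNReal.ofReal (q w) := by
    intro w
    rw [Measure.map_apply hY (measurableSet_singleton w), ← hlaw w, measureReal_def,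
      ENNReal.ofReal_toReal (measure_ne_top _ _)]
    rfl
  simp only [hm]
  rw [Finset.sum_congr rfl fun w _ => by
    rw [mul_comm, ← ENNReal.ofReal_mul (hq w).le],
    ← ENNReal.ofReal_sum_of_nonneg fun w _ => mul_nonneg (hq w).le (Real.exp_pos _).le]
  exact ENNReal.ofReal_le_ofReal (sum_mul_exp_log_div_le hp hq hps hqs ha0 ha1)

end Affinity

/-! ### Evidence accumulated along a fixed schedule -/

section Evidence

variable {V Θ : Type*} [Fintype V] {S : V → Type*}

/-- What the network accumulates by iteration `t` when agent `j` contributes `x r j` in iteration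
`r + 1` and contributions are averaged in every later iteration. -/
noncomputable def Schedule.accumulated (σ : Schedule V) (x : ℕ → V → ℝ) (t : ℕ) : V → ℝ :=
  ∑ r ∈ Finset.range t, (σ.transition (r + 1) t).mulVec (x r)

lemma Schedule.accumulated_succ (σ : Schedule V) (x : ℕ → V → ℝ) (t : ℕ) :
    σ.accumulated x (t + 1) = (σ.avg (t + 1)).mulVec (σ.accumulated x t) + x t := by
  classical
  rw [Schedule.accumulated, Finset.sum_range_succ, σ.transition_of_le le_rfl, Matrix.one_mulVec,
    Schedule.accumulated, Matrix.mulVec_sum]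
  congr 1
  refine Finset.sum_congr rfl fun r hr => ?_
  rw [σ.transition_succ (Finset.mem_range.1 hr), Matrix.mulVec_mulVec]

/-- The log-likelihood ratio of `θ` against `θ'` for the signal of agent `j` in iteration `r + 1`,
as a function of the family `y` of all signals at iterations `≥ 1`. -/
noncomputable def logLikelihoodRatio (ℓ : (i : V) → Θ → S i → ℝ) (θ θ' : Θ)
    (y : (p : {t : ℕ // 1 ≤ t} × V) → S p.2) (r : ℕ) (j : V) : ℝ :=
  Real.log (ℓ j θ (y (⟨r + 1, Nat.succ_pos r⟩, j)) / ℓ j θ' (y (⟨r + 1, Nat.succ_pos r⟩, j)))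

/-- On every source component of a reduced graph some agent can tell `θ` from `θ'`. -/
lemma SourceIdentifiable.exists_ne [∀ i, Fintype (S i)] {G : Digraph V} {f : ℕ}
    {ℓ : (i : V) → Θ → S i → ℝ} (h : SourceIdentifiable G f ℓ) (hℓ : IsSignalStructure ℓ)
    {θ θ' : Θ} (hne : θ ≠ θ') {H : SubDigraph V} (hH : IsReducedGraph G f H) {C : Finset V}
    (hC : H.IsSourceComponent C) : ∃ j ∈ C, ℓ j θ ≠ ℓ j θ' := by
  by_contra! hall
  refine h θ θ' hne H hH C hC (Finset.sum_eq_zero fun j hj => ?_)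
  rw [hall j hj]
  exact Finset.sum_eq_zero fun v _ => by rw [div_self (hℓ.pos _ _ v).ne', Real.log_one, mul_zero]

variable [∀ i, Fintype (S i)] [∀ i, MeasurableSpace (S i)] [∀ i, MeasurableSingletonClass (S i)]
  {G : Digraph V} {f : ℕ} {ℓ : (i : V) → Θ → S i → ℝ} {θ θstar : Θ}
  {Ω : Type*} [MeasurableSpace Ω] {P : Measure Ω} [IsProbabilityMeasure P]
  {s : ℕ → (i : V) → Ω → S i}

/-- Exponential moment bound: independence factorizes the moment, and each factor is bounded by a
power of a Hellinger affinity. -/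
lemma Schedule.lintegral_exp_accumulated_le (σ : Schedule V) (hℓ : IsSignalStructure ℓ)
    (hs : ∀ t i, Measurable (s t i))
    (hs_law : ∀ t, 1 ≤ t → ∀ i w, P.real {ω | s t i ω = w} = ℓ i θstar w)
    (hs_indep : iIndepFun (fun (p : {t : ℕ // 1 ≤ t} × V) ω => s p.1 p.2 ω) P) (t : ℕ) (i : V) :
    ∫⁻ ω, ENNReal.ofReal (Real.exp (σ.accumulated
        (logLikelihoodRatio ℓ θ θstar fun p => s p.1 p.2 ω) t i / 2)) ∂P ≤
      ENNReal.ofReal (Real.exp (-∑ r ∈ Finset.range t, (σ.transition (r + 1) t).mulVec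
        (fun j => -Real.log (affinity (ℓ j θ) (ℓ j θstar))) i)) := by
  set w : ℕ × V → ℝ := fun p => σ.transition (p.1 + 1) t i p.2 with hw
  set X : ℕ × V → Ω → ENNReal := fun p ω => ENNReal.ofReal (Real.exp
    (w p * Real.log (ℓ p.2 θ (s (p.1 + 1) p.2 ω) / ℓ p.2 θstar (s (p.1 + 1) p.2 ω)) / 2)) with hX
  have hXm : ∀ p, Measurable (X p) := fun p => Measurable.comp
    (g := fun v => ENNReal.ofReal (Real.exp
      (w p * Real.log (ℓ p.2 θ v / ℓ p.2 θstar v) / 2))) Measurable.of_discrete (hs _ _)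
  have hXi : iIndepFun X P := by
    have h1 := hs_indep.precomp (g := fun p : ℕ × V => (⟨p.1 + 1, Nat.succ_pos p.1⟩, p.2))
      (fun p q hpq => by
        simp only [Prod.mk.injEq, Subtype.mk.injEq, Nat.add_right_cancel_iff] at hpq
        exact Prod.ext hpq.1 hpq.2)
    exact h1.comp (fun p v => ENNReal.ofReal (Real.exp
      (w p * Real.log (ℓ p.2 θ v / ℓ p.2 θstar v) / 2))) fun p => Measurable.of_discrete
  have hprod : ∀ ω, ENNReal.ofReal (Real.exp (σ.accumulated
      (logLikelihoodRatio ℓ θ θstar fun p => s p.1 p.2 ω) t i / 2)) =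
      ∏ p ∈ Finset.range t ×ˢ Finset.univ, X p ω := by
    intro ω
    simp only [hX]
    rw [← ENNReal.ofReal_prod_of_nonneg fun p _ => (Real.exp_pos _).le, ← Real.exp_sum,
      Finset.sum_product, Schedule.accumulated, Finset.sum_apply, Finset.sum_div]
    simp only [Matrix.mulVec, dotProduct, Finset.sum_div]
    rfl
  simp only [hprod]
  rw [lintegral_prod_eq_prod_lintegral_of_indepFun _ X hXi hXm]
  have hle : ∀ p ∈ Finset.range t ×ˢ (Finset.univ : Finset V), ∫⁻ ω, X p ω ∂P ≤
      ENNReal.ofReal (Real.exp (w p * Real.log (affinity (ℓ p.2 θ) (ℓ p.2 θstar)))) := fun p _ =>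
    lintegral_exp_log_div_le (hℓ.pos _ _) (hℓ.pos _ _) (hℓ.sum_eq_one _ _) (hℓ.sum_eq_one _ _)
      (hs _ _) (hs_law _ (Nat.succ_pos _) _) (σ.transition_nonneg _ _ _ _)
      (σ.transition_le_one _ _ _ _)
  refine (Finset.prod_le_prod' hle).trans_eq ?_
  rw [← ENNReal.ofReal_prod_of_nonneg fun p _ => (Real.exp_pos _).le, ← Real.exp_sum,
    Finset.sum_product]
  simp only [Matrix.mulVec, dotProduct, hw, mul_neg, Finset.sum_neg_distrib, neg_neg]

/-- For a fixed schedule, the accumulated evidence in favour of a false hypothesis tends to `-∞`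
almost surely at every non-faulty agent: its exponential moments decay geometrically. -/
lemma Schedule.IsAdmissible.ae_tendsto_accumulated {σ : Schedule V} (h : σ.IsAdmissible G f)
    (hident : SourceIdentifiable G f ℓ) (hℓ : IsSignalStructure ℓ) (hne : θ ≠ θstar)
    (hs : ∀ t i, Measurable (s t i))
    (hs_law : ∀ t, 1 ≤ t → ∀ i w, P.real {ω | s t i ω = w} = ℓ i θstar w)
    (hs_indep : iIndepFun (fun (p : {t : ℕ // 1 ≤ t} × V) ω => s p.1 p.2 ω) P)
    {i : V} (hi : i ∈ σ.nonFaulty) :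
    ∀ᵐ ω ∂P, Filter.Tendsto (fun t => σ.accumulated
      (logLikelihoodRatio ℓ θ θstar fun p => s p.1 p.2 ω) t i) Filter.atTop Filter.atBot := by
  set δ : V → ℝ := fun j => -Real.log (affinity (ℓ j θ) (ℓ j θstar))
  have hδ0 : ∀ j, 0 ≤ δ j := fun j => neg_nonneg.2 (Real.log_nonpos
    (affinity_pos (hℓ.pos _ _) (hℓ.pos _ _) (hℓ.sum_eq_one _ _)).le
    (affinity_le_one (hℓ.pos _ _) (hℓ.pos _ _) (hℓ.sum_eq_one _ _) (hℓ.sum_eq_one _ _)))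
  obtain ⟨T, hT⟩ := h.exists_alive_eq_nonFaulty
  obtain ⟨c, hc, hcle⟩ := h.exists_pos_le_transition_mulVec hT hδ0 fun H hH C hC => by
    obtain ⟨j, hj, hjne⟩ := hident.exists_ne hℓ hne hH hC
    exact ⟨j, hj, neg_pos.2 (Real.log_neg
      (affinity_pos (hℓ.pos _ _) (hℓ.pos _ _) (hℓ.sum_eq_one _ _))
      (affinity_lt_one (hℓ.pos _ _) (hℓ.pos _ _) (hℓ.sum_eq_one _ _) (hℓ.sum_eq_one _ _) hjne))⟩
  set B := Fintype.card V
  -- The contributions of the iterations `T + 1, …, T + n` are discounted by at least `exp (-c)`.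
  have hexp : ∀ n : ℕ, (n : ℝ) * c ≤ ∑ r ∈ Finset.range (n + (T + B)),
      (σ.transition (r + 1) (n + (T + B))).mulVec δ i := by
    intro n
    calc (n : ℝ) * c = (Finset.Ico T (T + n)).card • c := by simp
      _ ≤ ∑ r ∈ Finset.Ico T (T + n), (σ.transition (r + 1) (n + (T + B))).mulVec δ i := by
        refine Finset.card_nsmul_le_sum _ _ _ fun r hr => ?_
        have := Finset.mem_Ico.1 hr
        exact hcle (r + 1) (by omega) _ (by omega) i hi
      _ ≤ _ := by
        refine Finset.sum_le_sum_of_subset_of_nonneg (fun r hr => ?_) fun r _ _ =>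
          σ.transition_mulVec_nonneg _ _ hδ0 i
        have := Finset.mem_Ico.1 hr
        exact Finset.mem_range.2 (by omega)
  set F : ℕ → Ω → ℝ := fun t ω => σ.accumulated
    (logLikelihoodRatio ℓ θ θstar fun p => s p.1 p.2 ω) t i with hF
  have hFm : ∀ t, Measurable (F t) := by
    intro t
    simp only [hF, Schedule.accumulated, Finset.sum_apply, Matrix.mulVec, dotProduct]
    refine Finset.measurable_fun_sum _ fun r _ => Finset.measurable_fun_sum _ fun j _ =>
      Measurable.const_mul ?_ _
    exact Measurable.comp (g := fun v => Real.log (ℓ j θ v / ℓ j θstar v))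
      Measurable.of_discrete (hs (r + 1) j)
  have hbound : ∀ n, ∫⁻ ω, ENNReal.ofReal (Real.exp (F (n + (T + B)) ω / 2)) ∂P ≤
      ENNReal.ofReal (Real.exp (-c)) ^ n := by
    intro n
    refine (σ.lintegral_exp_accumulated_le hℓ hs hs_law hs_indep _ i).trans ?_
    rw [← ENNReal.ofReal_pow (Real.exp_pos _).le, ← Real.exp_nat_mul]
    refine ENNReal.ofReal_le_ofReal (Real.exp_le_exp.2 ?_)
    have := hexp n
    linarith
  have hmeas : ∀ n, Measurable fun ω => ENNReal.ofReal (Real.exp (F (n + (T + B)) ω / 2)) :=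
    fun n => ENNReal.measurable_ofReal.comp (Real.measurable_exp.comp ((hFm _).div_const 2))
  have hfin : ∫⁻ ω, ∑' n, ENNReal.ofReal (Real.exp (F (n + (T + B)) ω / 2)) ∂P ≠ ⊤ := by
    rw [lintegral_tsum fun n => (hmeas n).aemeasurable]
    refine ne_top_of_le_ne_top ?_ (ENNReal.tsum_le_tsum hbound)
    rw [ENNReal.tsum_geometric]
    refine ENNReal.inv_ne_top.2 (tsub_pos_of_lt ?_).ne'
    rw [← ENNReal.ofReal_one]
    exact (ENNReal.ofReal_lt_ofReal_iff one_pos).2 (by rw [Real.exp_lt_one_iff]; linarith)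
  filter_upwards [ae_lt_top' (Measurable.tsum hmeas).aemeasurable hfin] with ω hω
  have h1 := (ENNReal.tendsto_toReal ENNReal.zero_ne_top).comp
    (ENNReal.tendsto_atTop_zero_of_tsum_ne_top hω.ne)
  have h2 : Filter.Tendsto (fun n => Real.exp (F (n + (T + B)) ω / 2)) Filter.atTop (𝓝 0) := by
    refine h1.congr fun n => ?_
    exact ENNReal.toReal_ofReal (Real.exp_pos _).le
  have h3 := (Filter.tendsto_add_atTop_iff_nat (f := fun t => F t ω / 2) (T + B)).1
    (Real.tendsto_exp_comp_nhds_zero.1 h2)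
  refine (h3.atBot_mul_const (zero_lt_two' ℝ)).congr fun t => ?_
  ring

end Evidence

/-! ### Random schedules independent of the signals -/

/-- Fubini: for independent `X` and `Y`, an event of the pair `(X, Y)` is almost sure if it is
almost sure for every frozen value of `X`. -/
lemma ae_mem_of_indepFun {Ω α β : Type*} [MeasurableSpace Ω] [MeasurableSpace α]
    [MeasurableSpace β] {P : Measure Ω} [IsFiniteMeasure P] {X : Ω → α} {Y : Ω → β}
    (hX : Measurable X) (hY : Measurable Y) (hXY : IndepFun X Y P) {A : Set (α × β)}
    (hA : MeasurableSet A) (h : ∀ ω, ∀ᵐ ω' ∂P, (X ω, Y ω') ∈ A) :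
    ∀ᵐ ω ∂P, (X ω, Y ω) ∈ A := by
  suffices P.map (fun ω => (X ω, Y ω)) Aᶜ = 0 by
    rw [Measure.map_apply (hX.prodMk hY) hA.compl] at this
    exact this
  rw [(indepFun_iff_map_prod_eq_prod_map_map hX.aemeasurable hY.aemeasurable).1 hXY,
    Measure.prod_apply hA.compl, lintegral_map (measurable_measure_prodMk_left hA.compl) hX]
  refine (lintegral_congr fun ω => ?_).trans lintegral_zero
  rw [Measure.map_apply hY (measurable_prodMk_left hA.compl)]
  exact h ω

section Measurability

variable {V : Type*}

lemma Schedule.measurable_alive (t : ℕ) : Measurable fun σ : Schedule V => σ.alive t :=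
  (measurable_pi_apply t).comp (measurable_fst.comp
    (comap_measurable fun σ : Schedule V => (σ.alive, σ.recv)))

lemma Schedule.measurable_recv (t : ℕ) (i : V) :
    Measurable fun σ : Schedule V => σ.recv t i :=
  (measurable_pi_apply i).comp ((measurable_pi_apply t).comp (measurable_snd.comp
    (comap_measurable fun σ : Schedule V => (σ.alive, σ.recv))))

variable [Fintype V]

lemma Schedule.measurable_avg (t : ℕ) (i j : V) :
    Measurable fun σ : Schedule V => σ.avg t i j := by
  classical
  exact Measurable.comp (g := fun R : Finset V =>
    if j ∈ insert i R then ((insert i R).card : ℝ)⁻¹ else 0) Measurable.of_discrete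
    (Schedule.measurable_recv t i)

lemma Schedule.measurable_transition (r t : ℕ) (i j : V) :
    Measurable fun σ : Schedule V => σ.transition r t i j := by
  classical
  induction t generalizing i with
  | zero => exact measurable_const
  | succ t ih =>
    by_cases h : r ≤ t
    · simp only [Schedule.transition_succ _ h, Matrix.mul_apply]
      exact Finset.measurable_fun_sum _ fun k _ => (Schedule.measurable_avg _ _ _).mul (ih k)
    · simp only [Schedule.transition, h, if_false]
      exact measurable_const

lemma Schedule.measurableSet_mem_nonFaulty (i : V) :
    MeasurableSet {σ : Schedule V | i ∈ σ.nonFaulty} := by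
  simp only [Schedule.mem_nonFaulty, Set.ofPred_forall]
  exact MeasurableSet.iInter fun t => Schedule.measurable_alive t (measurableSet_mem_finset i)

end Measurability

section RandomSchedule

variable {V Θ : Type*} [Fintype V] {S : V → Type*}
  [∀ i, Fintype (S i)] [∀ i, MeasurableSpace (S i)] [∀ i, MeasurableSingletonClass (S i)]
  {G : Digraph V} {f : ℕ} {ℓ : (i : V) → Θ → S i → ℝ} {θ θstar : Θ}
  {Ω : Type*} [MeasurableSpace Ω] {P : Measure Ω} [IsProbabilityMeasure P]
  {s : ℕ → (i : V) → Ω → S i} {σ : Ω → Schedule V}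

/-- The fixed-schedule statement carries over to a random schedule independent of the signals. -/
lemma ae_tendsto_accumulated (hident : SourceIdentifiable G f ℓ) (hℓ : IsSignalStructure ℓ)
    (hne : θ ≠ θstar) (hs : ∀ t i, Measurable (s t i))
    (hs_law : ∀ t, 1 ≤ t → ∀ i w, P.real {ω | s t i ω = w} = ℓ i θstar w)
    (hs_indep : iIndepFun (fun (p : {t : ℕ // 1 ≤ t} × V) ω => s p.1 p.2 ω) P)
    (hσ : Measurable σ) (hσ_adm : ∀ ω, (σ ω).IsAdmissible G f)
    (hσ_indep : IndepFun σ (fun ω (p : {t : ℕ // 1 ≤ t} × V) => s p.1 p.2 ω) P) (i : V) :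
    ∀ᵐ ω ∂P, i ∈ (σ ω).nonFaulty → Filter.Tendsto (fun t => (σ ω).accumulated
      (logLikelihoodRatio ℓ θ θstar fun p => s p.1 p.2 ω) t i) Filter.atTop Filter.atBot := by
  refine ae_mem_of_indepFun (A := {z | i ∈ z.1.nonFaulty → Filter.Tendsto (fun t =>
    z.1.accumulated (logLikelihoodRatio ℓ θ θstar z.2) t i) Filter.atTop Filter.atBot})
    hσ (measurable_pi_lambda _ fun p => hs _ _) hσ_indep ?_ ?_
  · have h1 : MeasurableSet {z : Schedule V × ((p : {t : ℕ // 1 ≤ t} × V) → S p.2) |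
        Filter.Tendsto (fun t => z.1.accumulated (logLikelihoodRatio ℓ θ θstar z.2) t i)
          Filter.atTop Filter.atBot} := by
      refine measurableSet_tendsto _ fun t => ?_
      simp only [Schedule.accumulated, Finset.sum_apply, Matrix.mulVec, dotProduct]
      refine Finset.measurable_fun_sum _ fun r _ => Finset.measurable_fun_sum _ fun j _ => ?_
      refine ((Schedule.measurable_transition _ _ _ _).comp measurable_fst).mul ?_
      exact Measurable.comp (g := fun v => Real.log (ℓ j θ v / ℓ j θstar v))
        Measurable.of_discrete ((measurable_pi_apply (_ : {t : ℕ // 1 ≤ t} × V)).comp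
          measurable_snd)
    exact (measurable_fst (Schedule.measurableSet_mem_nonFaulty i)).imp h1
  · intro ω
    by_cases hi : i ∈ (σ ω).nonFaulty
    · filter_upwards [(hσ_adm ω).ae_tendsto_accumulated hident hℓ hne hs hs_law hs_indep hi]
        with ω' hω' _ using hω'
    · exact Filter.Eventually.of_forall fun ω' h => (hi h).elim

end RandomSchedule

/-! ### Log-belief ratios -/

section Beliefs

variable {V Θ : Type*} [Fintype V] {S : V → Type*} [∀ i, Fintype (S i)]
  {G : Digraph V} {f : ℕ} {ℓ : (i : V) → Θ → S i → ℝ} {μ₀ : V → Θ → ℝ} {σ : Schedule V}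
  {s : ℕ → (i : V) → S i} {μ : ℕ → V → Θ → ℝ}

lemma weight_pos (hℓ : IsSignalStructure ℓ) {i : V} {w : S i} {R : Finset V} {b : V → Θ → ℝ}
    {θ : Θ} (hi : 0 < b i θ) (hR : ∀ j ∈ R, 0 < b j θ) : 0 < weight G f ℓ i w R b θ := by
  classical
  refine mul_pos (hℓ.pos _ _ _) (Finset.prod_pos fun j hj => Real.rpow_pos_of_pos ?_ _)
  rcases Finset.mem_insert.1 hj with rfl | hj
  exacts [hi, hR j hj]

variable [Fintype Θ]

lemma IsBeliefEvolution.pos (hμ : IsBeliefEvolution G f ℓ μ₀ σ s μ) (h : σ.IsAdmissible G f)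
    (hℓ : IsSignalStructure ℓ) (hμ₀ : ∀ i θ, 0 < μ₀ i θ) (t : ℕ) {i : V} (hi : i ∈ σ.alive t)
    (θ : Θ) : 0 < μ t i θ := by
  classical
  induction t generalizing i θ with
  | zero =>
    rw [hμ.init]
    exact hμ₀ i θ
  | succ t ih =>
    have hw : ∀ θ, 0 < weight G f ℓ i (s (t + 1) i) (σ.recv (t + 1) i) (μ t) θ := fun θ =>
      weight_pos hℓ (ih (h.alive_antitone t hi) θ) fun j hj =>
        ih (Finset.mem_inter.1 (h.recv_subset t i hi hj)).2 θ
    rw [hμ.step t i hi θ]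
    exact div_pos (hw θ) (Finset.sum_pos (fun θ' _ => hw θ') ⟨θ, Finset.mem_univ θ⟩)

lemma IsBeliefEvolution.sum_eq_one (hμ : IsBeliefEvolution G f ℓ μ₀ σ s μ)
    (h : σ.IsAdmissible G f) (hℓ : IsSignalStructure ℓ) (hμ₀ : ∀ i θ, 0 < μ₀ i θ)
    (hμ₀_sum : ∀ i, ∑ θ, μ₀ i θ = 1) (t : ℕ) {i : V} (hi : i ∈ σ.alive t) :
    ∑ θ, μ t i θ = 1 := by
  cases t with
  | zero => simpa only [hμ.init] using hμ₀_sum i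
  | succ t =>
    have hne : ∑ θ, μ (t + 1) i θ ≠ 0 := by
      have hΘ : (Finset.univ : Finset Θ).Nonempty := by
        by_contra hΘ
        have := hμ₀_sum i
        rw [Finset.not_nonempty_iff_eq_empty.1 hΘ] at this
        simp at this
      exact (Finset.sum_pos (fun θ _ => hμ.pos h hℓ hμ₀ (t + 1) hi θ) hΘ).ne'
    simp only [hμ.step t i hi, ← Finset.sum_div] at hne ⊢
    exact div_self fun h0 => hne (by rw [h0, div_zero])

/-- Geometric averaging of beliefs is arithmetic averaging of log-belief ratios; the normalizing
constants cancel. -/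
lemma IsBeliefEvolution.log_ratio_succ (hμ : IsBeliefEvolution G f ℓ μ₀ σ s μ)
    (hG : ∀ i, ¬ G.Adj i i) (h : σ.IsAdmissible G f) (hℓ : IsSignalStructure ℓ)
    (hμ₀ : ∀ i θ, 0 < μ₀ i θ) (t : ℕ) {i : V} (hi : i ∈ σ.alive (t + 1)) (θ θ' : Θ) :
    Real.log (μ (t + 1) i θ / μ (t + 1) i θ') =
      (σ.avg (t + 1)).mulVec (fun j => Real.log (μ t j θ / μ t j θ')) i +
        Real.log (ℓ i θ (s (t + 1) i) / ℓ i θ' (s (t + 1) i)) := by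
  classical
  set R := σ.recv (t + 1) i
  have hpos : ∀ j ∈ insert i R, ∀ θ, 0 < μ t j θ := by
    intro j hj θ
    rcases Finset.mem_insert.1 hj with rfl | hj
    · exact hμ.pos h hℓ hμ₀ t (h.alive_antitone t hi) θ
    · exact hμ.pos h hℓ hμ₀ t (Finset.mem_inter.1 (h.recv_subset t i hi hj)).2 θ
  have hiR : i ∉ R := fun hiR =>
    hG i (mem_inNeighbors.1 (Finset.mem_inter.1 (h.recv_subset t i hi hiR)).1)
  -- The insertion of `i` accounts for the `+ 1` in the exponent because there are no self-loops.
  have hexp : 1 / (((inNeighbors G i).card : ℝ) - f + 1) = ((insert i R).card : ℝ)⁻¹ := by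
    have := h.recv_card t i hi
    rw [← this, Finset.card_insert_of_notMem hiR, one_div]
    push_cast
    ring
  have hw : ∀ θ, 0 < weight G f ℓ i (s (t + 1) i) R (μ t) θ := fun θ =>
    weight_pos hℓ (hpos i (Finset.mem_insert_self _ _) θ) fun j hj =>
      hpos j (Finset.mem_insert_of_mem hj) θ
  have hlog : ∀ θ, Real.log (weight G f ℓ i (s (t + 1) i) R (μ t) θ) =
      Real.log (ℓ i θ (s (t + 1) i)) +
        ((insert i R).card : ℝ)⁻¹ * ∑ j ∈ insert i R, Real.log (μ t j θ) := by
    intro θ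
    rw [weight, Real.log_mul (hℓ.pos _ _ _).ne' (Finset.prod_pos fun j hj =>
      Real.rpow_pos_of_pos (hpos j hj θ) _).ne', Real.log_prod fun j hj =>
      (Real.rpow_pos_of_pos (hpos j hj θ) _).ne', Finset.mul_sum, hexp]
    congr 1
    exact Finset.sum_congr rfl fun j hj => Real.log_rpow (hpos j hj θ) _
  have hsum : ∑ θ'', weight G f ℓ i (s (t + 1) i) R (μ t) θ'' ≠ 0 :=
    (Finset.sum_pos (fun θ'' _ => hw θ'') ⟨θ, Finset.mem_univ θ⟩).ne'
  rw [hμ.step t i hi θ, hμ.step t i hi θ', div_div_div_cancel_right₀ hsum,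
    Real.log_div (hw θ).ne' (hw θ').ne', hlog, hlog, σ.avg_mulVec,
    Real.log_div (hℓ.pos _ _ _).ne' (hℓ.pos _ _ _).ne',
    Finset.sum_congr rfl fun j hj => Real.log_div (hpos j hj θ).ne' (hpos j hj θ').ne',
    Finset.sum_sub_distrib]
  ring

/-- Unrolled form: the log-belief ratio of a running agent is an average of the initial ones plus the
accumulated evidence. Crashed agents, whose beliefs are unconstrained, do not enter, since messages
are received only from agents that were still running. -/
lemma IsBeliefEvolution.log_ratio_eq (hμ : IsBeliefEvolution G f ℓ μ₀ σ s μ)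
    (hG : ∀ i, ¬ G.Adj i i) (h : σ.IsAdmissible G f) (hℓ : IsSignalStructure ℓ)
    (hμ₀ : ∀ i θ, 0 < μ₀ i θ) (t : ℕ) {i : V} (hi : i ∈ σ.alive t) (θ θ' : Θ) :
    Real.log (μ t i θ / μ t i θ') =
      (σ.transition 0 t).mulVec (fun j => Real.log (μ₀ j θ / μ₀ j θ')) i +
        σ.accumulated (logLikelihoodRatio ℓ θ θ' fun p => s p.1 p.2) t i := by
  classical
  induction t generalizing i with
  | zero => simp [hμ.init, Schedule.accumulated, σ.transition_of_le le_rfl]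
  | succ t ih =>
    rw [hμ.log_ratio_succ hG h hℓ hμ₀ t hi, σ.accumulated_succ, σ.transition_succ (Nat.zero_le t),
      ← Matrix.mulVec_mulVec, Pi.add_apply, ← add_assoc, ← Pi.add_apply, ← Matrix.mulVec_add,
      σ.avg_mulVec, σ.avg_mulVec]
    congr 2
    refine Finset.sum_congr rfl fun j hj => ih ?_
    rcases Finset.mem_insert.1 hj with rfl | hj
    · exact h.alive_antitone t hi
    · exact (Finset.mem_inter.1 (h.recv_subset t i hi hj)).2

/-- Averages of the initial log-belief ratios stay bounded, so accumulated evidence tending to `-∞`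
drives the belief ratio to `0`. -/
lemma IsBeliefEvolution.tendsto_ratio (hμ : IsBeliefEvolution G f ℓ μ₀ σ s μ)
    (hG : ∀ i, ¬ G.Adj i i) (h : σ.IsAdmissible G f) (hℓ : IsSignalStructure ℓ)
    (hμ₀ : ∀ i θ, 0 < μ₀ i θ) {i : V} (hi : i ∈ σ.nonFaulty) {θ θ' : Θ}
    (hlim : Filter.Tendsto (fun t => σ.accumulated
      (logLikelihoodRatio ℓ θ θ' fun p => s p.1 p.2) t i) Filter.atTop Filter.atBot) :
    Filter.Tendsto (fun t => μ t i θ / μ t i θ') Filter.atTop (𝓝 0) := by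
  have halive := Schedule.mem_nonFaulty.1 hi
  have hle : ∀ t, (σ.transition 0 t).mulVec (fun j => Real.log (μ₀ j θ / μ₀ j θ')) i ≤
      ∑ j, |Real.log (μ₀ j θ / μ₀ j θ')| := fun t =>
    Finset.sum_le_sum fun j _ => (mul_le_mul_of_nonneg_left (le_abs_self _)
      (σ.transition_nonneg _ _ _ _)).trans
      (mul_le_of_le_one_left (abs_nonneg _) (σ.transition_le_one _ _ _ _))
  refine (Real.tendsto_exp_comp_nhds_zero.2
    (Filter.tendsto_atBot_add_left_of_ge _ _ hle hlim)).congr fun t => ?_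
  rw [← hμ.log_ratio_eq hG h hℓ hμ₀ t (halive t), Real.exp_log]
  exact div_pos (hμ.pos h hℓ hμ₀ t (halive t) _) (hμ.pos h hℓ hμ₀ t (halive t) _)

end Beliefs

/-- A probability vector concentrates at `a` if its other entries vanish relative to entry `a`. -/
lemma tendsto_one_of_tendsto_div {Θ : Type*} [Fintype Θ] {p : ℕ → Θ → ℝ} {a : Θ}
    (hpos : ∀ t, 0 < p t a) (hsum : ∀ t, ∑ b, p t b = 1)
    (h : ∀ b ≠ a, Filter.Tendsto (fun t => p t b / p t a) Filter.atTop (𝓝 0)) :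
    Filter.Tendsto (fun t => p t a) Filter.atTop (𝓝 1) := by
  classical
  have h1 : Filter.Tendsto (fun t => ∑ b, p t b / p t a) Filter.atTop
      (𝓝 (∑ b, if b = a then 1 else 0)) := by
    refine tendsto_finsetSum _ fun b _ => ?_
    by_cases hb : b = a
    · subst hb
      simp [div_self (hpos _).ne']
    · simpa [hb] using h b hb
  rw [Finset.sum_ite_eq' Finset.univ a, if_pos (Finset.mem_univ a)] at h1
  have h2 := h1.inv₀ one_ne_zero
  rw [inv_one] at h2
  refine h2.congr fun t => ?_
  rw [← Finset.sum_div, hsum, one_div, inv_inv]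

end CrashLearning

theorem mainTheorem1
    {V Θ : Type*} [Fintype V] [Fintype Θ]
    {S : V → Type*} [∀ i, Fintype (S i)] [∀ i, MeasurableSpace (S i)]
    [∀ i, MeasurableSingletonClass (S i)]
    -- the network, without self-loops, and the bound on the number of crashes
    (G : Digraph V) (hG : ∀ i, ¬ G.Adj i i) (f : ℕ)
    (hsource : CrashLearning.UniqueSourceCondition G f)
    -- the signal distributions
    (ℓ : (i : V) → Θ → S i → ℝ) (hℓ : CrashLearning.IsSignalStructure ℓ)
    (hident : CrashLearning.SourceIdentifiable G f ℓ)
    -- the initial beliefs: arbitrary distributions with full support, for instance uniform ones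
    (μ₀ : V → Θ → ℝ) (hμ₀ : ∀ i θ, 0 < μ₀ i θ) (hμ₀_sum : ∀ i, ∑ θ, μ₀ i θ = 1)
    -- the true state
    (θstar : Θ)
    {Ω : Type*} [MeasurableSpace Ω] (P : Measure Ω) [IsProbabilityMeasure P]
    -- the signals at iterations `t ≥ 1`, independent over time and agents, with laws `ℓ i θstar`
    (s : ℕ → (i : V) → Ω → S i) (hs : ∀ t i, Measurable (s t i))
    (hs_law : ∀ t, 1 ≤ t → ∀ i w, P.real {ω | s t i ω = w} = ℓ i θstar w)
    (hs_indep : iIndepFun (fun (p : {t : ℕ // 1 ≤ t} × V) ω => s p.1 p.2 ω) P)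
    -- the crash pattern and the receive sets: deterministic, or random and independent of the signals
    (σ : Ω → CrashLearning.Schedule V) (hσ : Measurable σ)
    (hσ_adm : ∀ ω, (σ ω).IsAdmissible G f)
    (hσ_indep : IndepFun σ (fun ω (p : {t : ℕ // 1 ≤ t} × V) => s p.1 p.2 ω) P)
    -- the beliefs
    (μ : ℕ → V → Θ → Ω → ℝ)
    (hμ : ∀ ω, CrashLearning.IsBeliefEvolution G f ℓ μ₀ (σ ω) (fun t i => s t i ω)
      (fun t i θ => μ t i θ ω)) :
    ∀ᵐ ω ∂P, ∀ i ∈ (σ ω).nonFaulty,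
      Filter.Tendsto (fun t => μ t i θstar ω) Filter.atTop (𝓝 1) := by
  have hall : ∀ᵐ ω ∂P, ∀ i, ∀ θ, θ ≠ θstar → i ∈ (σ ω).nonFaulty →
      Filter.Tendsto (fun t => (σ ω).accumulated (CrashLearning.logLikelihoodRatio ℓ θ θstar
        fun p => s p.1 p.2 ω) t i) Filter.atTop Filter.atBot := by
    rw [ae_all_iff]
    intro i
    rw [ae_all_iff]
    intro θ
    by_cases hθ : θ = θstar
    · exact Filter.Eventually.of_forall fun ω h => (h hθ).elim
    · filter_upwards [CrashLearning.ae_tendsto_accumulated hident hℓ hθ hs hs_law hs_indep hσ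
        hσ_adm hσ_indep i] with ω hω _ using hω
  filter_upwards [hall] with ω hω i hi
  have halive := CrashLearning.Schedule.mem_nonFaulty.1 hi
  exact CrashLearning.tendsto_one_of_tendsto_div (p := fun t θ => μ t i θ ω)
    (fun t => (hμ ω).pos (hσ_adm ω) hℓ hμ₀ t (halive t) θstar)
    (fun t => (hμ ω).sum_eq_one (hσ_adm ω) hℓ hμ₀ hμ₀_sum t (halive t))
    fun θ hθ => (hμ ω).tendsto_ratio hG (hσ_adm ω) hℓ hμ₀ hi (hω i θ hθ hi)
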